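/- Let $A$ be a $d\times n$ integer matrix, $n\ge 1$, with columns $a_1,\dots,a_n\in\mathbb Z^d$, and suppose there is $l\in\mathbb R^d$ with $\langle l,a_i\rangle<0$ for all $i$. Let $G=\{A\xi:\xi\in\mathbb Z^n,\ \xi\ge 0\}$ be the semigroup generated by the $a_i$ and $\Lambda=\{\lambda\in\mathbb Z^n: A\lambda=0\}$. For $z\in(\mathbb C\setminus\{0\})^d$ and $b\in\mathbb Z^d$ write $z^b=z_1^{b_1}\cdots z_d^{b_d}$. For vectors, $x<y$ means $x_i<y_i$ for all $i$, and $\max$ is taken coordinatewise; for a nonempty finite $s\subset\Lambda$ put $\dim s=|s|-1$. Call $\Lambda$ generic if for every nonzero $\lambda\in\Lambda$ with some zero coordinate there is $\lambda'\in\Lambda$ with $\lambda'<\max(\lambda,0)$. Call $\varphi:\Lambda\to\mathbb R^n$ a proper perturbation if for all $x,y\in\Lambda$ and all $i$: (1) if $x\ne y$ then $\varphi(x)_i\neq\varphi(y)_i$; (2) if $\varphi(x)_i<\varphi(y)_i$ then $x_i\le y_i$; (3) if $\varphi(x)_i<\varphi(y)_i$ then $\varphi(x+\lambda)_i<\varphi(y+\lambda)_i$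 for all $\lambda\in\Lambda$. Let the neighborhood complex $S$ be either (a) if $\Lambda$ is generic, the set of nonempty finite $s\subset\Lambda$ such that no $\lambda\in\Lambda$ satisfies $\lambda<\max(s)$; or (b) for any $\Lambda$ and any proper perturbation $\varphi$, the set of nonempty finite $s\subset\Lambda$ such that no $\lambda\in\Lambda$ satisfies $\varphi(\lambda)<\max(\varphi(s))$. Let $\bar S$ be any set of distinct representatives of $S$ modulo translation by $\Lambda$. Then the set of $z\in(\mathbb C\setminus\{0\})^d$ with $|z^{a_i}|<1$ for all $i$ is a neighborhood of $(e^{l_1},\dots,e^{l_d})$, and for every $z$ in this set the two sums below converge absolutely and $$\sum_{b\in G}z^b=\frac{\sum_{s\in\bar S}(-1)^{\dim s}z^{A\cdot\max(s)}}{\prod_{i=1}^n(1-z^{a_i})}.$$ In case (a) the set $\bar S$ is finite. -/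

import Mathlib

open Matrix Topology

namespace SemigroupGF

noncomputable section

/-- The lattice `Λ = {λ ∈ ℤⁿ : A λ = 0}`. -/
def kernelLattice {d n : ℕ} (A : Matrix (Fin d) (Fin n) ℤ) : AddSubgroup (Fin n → ℤ) :=
  A.mulVecLin.ker.toAddSubgroup

/-- The semigroup (with zero) `G = {A ξ : ξ ∈ ℤⁿ, ξ ≥ 0}` of all nonnegative integer
combinations of the columns of `A`. -/
def semigroup {d n : ℕ} (A : Matrix (Fin d) (Fin n) ℤ) : Set (Fin d → ℤ) :=
  {b | ∃ ξ : Fin n → ℤ, 0 ≤ ξ ∧ A *ᵥ ξ = b}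

/-- The coordinatewise maximum of the vectors `f v`, `v ∈ s`, for a nonempty finite set `s`
(the value at the empty set is never used). -/
def coordMax {V ι R : Type*} [LinearOrder R] [Zero R] (f : V → ι → R) (s : Finset V) : ι → R :=
  if h : s.Nonempty then s.sup' h f else 0

/-- `Λ` is generic: whenever a nonzero `v ∈ Λ` has a zero coordinate, some `w ∈ Λ` is strictly
smaller than `max(v, 0)` in every coordinate. -/
def IsGeneric {n : ℕ} (Λ : AddSubgroup (Fin n → ℤ)) : Prop :=
  ∀ v ∈ Λ, v ≠ 0 → (∃ i, v i = 0) → ∃ w ∈ Λ, ∀ j, w j < max (v j) 0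

/-- Proper perturbations `φ : Λ → ℝⁿ`. -/
structure IsProperPerturbation {n : ℕ} (Λ : AddSubgroup (Fin n → ℤ))
    (φ : Λ → Fin n → ℝ) : Prop where
  ne_of_ne : ∀ x y : Λ, x ≠ y → ∀ i, φ x i ≠ φ y i
  le_of_lt : ∀ (x y : Λ) (i : Fin n), φ x i < φ y i → (x : Fin n → ℤ) i ≤ (y : Fin n → ℤ) i
  add_lt_add : ∀ (x y : Λ) (i : Fin n), φ x i < φ y i → ∀ v : Λ, φ (x + v) i < φ (y + v) i

/-- The complex on the vertex set `V` placed in `Rⁿ` by `f`: its simplices are the nonempty finite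
sets `s` such that no vertex is strictly smaller, in all coordinates, than `max (f(s))`. -/
def complexOf {V : Type*} {n : ℕ} {R : Type*} [LinearOrder R] [Zero R] (f : V → Fin n → R) :
    Set (Finset V) :=
  {s | s.Nonempty ∧ ¬ ∃ v : V, ∀ i, f v i < coordMax f s i}

/-- The neighborhood complex of a generic lattice. -/
def neighborhoodComplex {n : ℕ} (Λ : AddSubgroup (Fin n → ℤ)) : Set (Finset Λ) :=
  complexOf (fun v : Λ => (v : Fin n → ℤ))

/-- The neighborhood complex of an arbitrary lattice, with respect to a proper
perturbation `φ`. -/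
def perturbedNeighborhoodComplex {n : ℕ} (Λ : AddSubgroup (Fin n → ℤ)) (φ : Λ → Fin n → ℝ) :
    Set (Finset Λ) :=
  complexOf φ

/-- The translate `s + v`. -/
def translate {n : ℕ} {Λ : AddSubgroup (Fin n → ℤ)} (v : Λ) (s : Finset Λ) : Finset Λ :=
  s.map (addRightEmbedding v)

/-- `T` is a set of distinct representatives of `S` modulo translation by `Λ`. -/
def IsSetOfRepresentatives {n : ℕ} {Λ : AddSubgroup (Fin n → ℤ)} (S T : Set (Finset Λ)) : Prop :=
  T ⊆ S ∧ ∀ s ∈ S, ∃! t, t ∈ T ∧ ∃ v : Λ, t = translate v s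

/-- The Laurent monomial `z^b = z₁^{b₁} ⋯ z_d^{b_d}`. -/
def laurentMonomial {d : ℕ} (z : Fin d → ℂ) (b : Fin d → ℤ) : ℂ :=
  ∏ j, z j ^ b j

/-- The points `z` with nonzero coordinates at which `|z^{a_i}| < 1` for all columns `a_i`. -/
def convergenceDomain {d n : ℕ} (A : Matrix (Fin d) (Fin n) ℤ) : Set (Fin d → ℂ) :=
  {z | (∀ j, z j ≠ 0) ∧ ∀ i, ‖laurentMonomial z (A.col i)‖ < 1}

/-- The generating function `f(z) = ∑_{b ∈ G} z^b`. -/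
def genFun {d n : ℕ} (A : Matrix (Fin d) (Fin n) ℤ) (z : Fin d → ℂ) : ℂ :=
  ∑' b : semigroup A, laurentMonomial z b

/-- The numerator term `(-1)^{dim s} z^{A · max(s)}`; here `max(s)` is taken in `ℤⁿ`. -/
def simplexTerm {d n : ℕ} (A : Matrix (Fin d) (Fin n) ℤ) (z : Fin d → ℂ)
    (s : Finset (kernelLattice A)) : ℂ :=
  (-1) ^ (s.card - 1) *
    laurentMonomial z (A *ᵥ coordMax (fun v : kernelLattice A => (v : Fin n → ℤ)) s)

/-- `f_T(z) = (∑_{s ∈ T} (-1)^{dim s} z^{A · max(s)}) / ∏_i (1 - z^{a_i})`. -/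
def complexFun {d n : ℕ} (A : Matrix (Fin d) (Fin n) ℤ) (T : Set (Finset (kernelLattice A)))
    (z : Fin d → ℂ) : ℂ :=
  (∑' s : T, simplexTerm A z s) / ∏ i, (1 - laurentMonomial z (A.col i))

/-- `f = f_T` on the convergence domain, where both series converge (absolutely). -/
def GenFunEq {d n : ℕ} (A : Matrix (Fin d) (Fin n) ℤ)
    (T : Set (Finset (kernelLattice A))) : Prop :=
  ∀ z ∈ convergenceDomain A,
    Summable (fun b : semigroup A => laurentMonomial z b) ∧
    Summable (fun s : T => simplexTerm A z s) ∧
    genFun A z = complexFun A T z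

end

end SemigroupGF

open SemigroupGF

/-! Expanding `1 / ∏ (1 - z^{a_i})` as a geometric series turns the right-hand side into a sum of
`(-1)^{dim s} z^{A(max s + η)}` over representatives `s` and `η ∈ ℕⁿ`. Group the terms by exponent
`b = A ξ`, `ξ ≥ 0`. Translating `s` by the lattice vector `ξ - max s - η` matches the pairs over `b`
with the simplices of the whole complex on the finite set `W = {v ∈ Λ : v ≤ ξ}` (`sum_fiber`). That
restricted complex has Euler characteristic 1 (`sum_neg_one_pow_card_filter_complexOf`), so each
`z^b` survives exactly once. Regrouping needs absolute convergence of the numerator: in the generic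
case it is a finite sum, by Dickson's lemma (`IsGeneric.finite_neighbors`); in the perturbed case a
simplex is encoded by at most `n` vertices, and the sum is dominated by a product of geometric
series (`IsProperPerturbation.summable_simplexTerm`). -/

namespace SemigroupGF

/-! ### Coordinatewise maxima. -/

section CoordMax

variable {V ι R : Type*} [LinearOrder R] [Zero R] {f : V → ι → R} {s t : Finset V}

lemma coordMax_le_iff (hs : s.Nonempty) {i : ι} {c : R} :
    coordMax f s i ≤ c ↔ ∀ v ∈ s, f v i ≤ c := by
  simp [coordMax, hs, Finset.sup'_apply]

lemma lt_coordMax_iff (hs : s.Nonempty) {i : ι} {c : R} :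
    c < coordMax f s i ↔ ∃ v ∈ s, c < f v i := by
  simp [coordMax, hs, Finset.sup'_apply]

lemma le_coordMax {v : V} (hv : v ∈ s) (i : ι) : f v i ≤ coordMax f s i :=
  (coordMax_le_iff ⟨v, hv⟩).1 le_rfl v hv

lemma coordMax_insert [DecidableEq V] (hs : s.Nonempty) {v : V}
    (hv : ∀ i, f v i < coordMax f s i) : coordMax f (insert v s) = coordMax f s := by
  funext i
  refine le_antisymm ((coordMax_le_iff (Finset.insert_nonempty v s)).2 fun u hu => ?_)
    ((coordMax_le_iff hs).2 fun u hu => le_coordMax (Finset.mem_insert_of_mem hu) i)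
  rcases Finset.mem_insert.1 hu with rfl | hu
  · exact (hv i).le
  · exact le_coordMax hu i

lemma coordMax_erase [DecidableEq V] (hs : s.Nonempty) (hs' : (s.erase v).Nonempty)
    (hv : ∀ i, f v i < coordMax f s i) : coordMax f (s.erase v) = coordMax f s := by
  funext i
  refine le_antisymm ((coordMax_le_iff hs').2 fun u hu => le_coordMax (Finset.mem_of_mem_erase hu) i)
    (le_of_not_gt fun h => ?_)
  -- A vertex exceeding both `v` and the supposed smaller maximum in coordinate `i` cannot be `v`,
  -- so it survives the erasure.
  obtain ⟨u, hu, hlt⟩ := (lt_coordMax_iff hs).1 (max_lt h (hv i))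
  have huv : u ≠ v := by
    rintro rfl
    exact absurd hlt (by simp)
  exact absurd (le_coordMax (f := f) (Finset.mem_erase.2 ⟨huv, hu⟩) i)
    (not_le.2 ((le_max_left _ _).trans_lt hlt))

lemma erase_nonempty_of_lt_coordMax [DecidableEq V] [Nonempty ι] (hs : s.Nonempty) {v : V}
    (hv : ∀ i, f v i < coordMax f s i) : (s.erase v).Nonempty := by
  obtain ⟨i⟩ := ‹Nonempty ι›
  obtain ⟨u, hu, hlt⟩ := (lt_coordMax_iff hs).1 (hv i)
  exact ⟨u, Finset.mem_erase.2 ⟨by rintro rfl; exact lt_irrefl _ hlt, hu⟩⟩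

end CoordMax

/-! ### Euler characteristic of a restricted complex. -/

open Classical in
/-- The reduced Euler characteristic of the complex restricted to `W` vanishes. -/
lemma sum_neg_one_pow_card_filter_complexOf {V R : Type*} [LinearOrder R] [Zero R] {n : ℕ}
    (hn : 0 < n) (f : V → Fin n → R) {W : Finset V} (hW : W.Nonempty)
    (hcl : ∀ s ⊆ W, s.Nonempty → ∀ v, (∀ i, f v i < coordMax f s i) → v ∈ W) :
    ∑ s ∈ W.powerset with s ∈ complexOf f, (-1 : ℤ) ^ s.card = -1 := by
  have : Nonempty (Fin n) := ⟨⟨0, hn⟩⟩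
  have : Nonempty V := hW.to_type
  have h0 := Finset.sum_powerset_neg_one_pow_card_of_nonempty hW
  have hbad : ∑ s ∈ (W.powerset.erase ∅) with s ∉ complexOf f, (-1 : ℤ) ^ s.card = 0 := by
    -- The chosen vertex depends on the maximum `m` only, not on the set; its value is arbitrary
    -- when nothing lies below `m`.
    have hex : ∀ m : Fin n → R, ∃ v, (∃ v, ∀ i, f v i < m i) → ∀ i, f v i < m i := fun m => by
      by_cases h : ∃ v, ∀ i, f v i < m i
      · exact ⟨h.choose, fun _ => h.choose_spec⟩
      · exact ⟨Classical.arbitrary V, fun h' => absurd h' h⟩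
    choose c hc using hex
    have hmem : ∀ s, s ∈ ((W.powerset.erase ∅).filter (fun s => s ∉ complexOf f)) ↔
        s ⊆ W ∧ s.Nonempty ∧ ∃ v, ∀ i, f v i < coordMax f s i := by
      intro s
      simp only [Finset.mem_filter, Finset.mem_erase, Finset.mem_powerset, complexOf,
        Set.mem_ofPred_eq, Finset.nonempty_iff_ne_empty]
      tauto
    -- Toggling a vertex strictly below the maximum leaves the maximum unchanged, so the same vertex
    -- is toggled back: a sign-reversing involution on the nonempty non-simplices.
    let g : Finset V → Finset V := fun s =>
      if c (coordMax f s) ∈ s then s.erase (c (coordMax f s)) else insert (c (coordMax f s)) s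
    have hmax : ∀ s, s.Nonempty → (∃ v, ∀ i, f v i < coordMax f s i) →
        coordMax f (g s) = coordMax f s := by
      intro s hs hv
      have hlt := hc _ hv
      simp only [g]
      split_ifs
      · exact coordMax_erase hs (erase_nonempty_of_lt_coordMax hs hlt) hlt
      · exact coordMax_insert hs hlt
    have hne : ∀ s, s.Nonempty → (∃ v, ∀ i, f v i < coordMax f s i) → (g s).Nonempty := by
      intro s hs hv
      simp only [g]
      split_ifs
      · exact erase_nonempty_of_lt_coordMax hs (hc _ hv)
      · exact Finset.insert_nonempty _ _
    refine Finset.sum_involution (fun s _ => g s) ?_ ?_ ?_ ?_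
    · intro s _
      simp only [g]
      split_ifs with h
      · rw [← Finset.card_erase_add_one h]; ring
      · rw [Finset.card_insert_of_notMem h]; ring
    · intro s _ _ heq
      by_cases h : c (coordMax f s) ∈ s
      · simp only [g, h, if_true] at heq
        exact absurd h (Finset.erase_eq_self.1 heq)
      · simp only [g, h, if_false] at heq
        exact h (Finset.insert_eq_self.1 heq)
    · intro s hs
      obtain ⟨hsW, hs, hv⟩ := (hmem s).1 hs
      refine (hmem _).2 ⟨?_, hne s hs hv, by rwa [hmax s hs hv]⟩
      simp only [g]
      split_ifs
      · exact (Finset.erase_subset _ _).trans hsW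
      · exact Finset.insert_subset (hcl s hsW hs _ (hc _ hv)) hsW
    · intro s hs
      obtain ⟨hsW, hs, hv⟩ := (hmem s).1 hs
      have h1 := hmax s hs hv
      by_cases h : c (coordMax f s) ∈ s
      · have h2 : g s = s.erase (c (coordMax f s)) := by simp only [g, h, if_true]
        change (if c (coordMax f (g s)) ∈ g s then _ else _) = _
        rw [h1, h2]
        simp [h]
      · have h2 : g s = insert (c (coordMax f s)) s := by simp only [g, h, if_false]
        change (if c (coordMax f (g s)) ∈ g s then _ else _) = _
        rw [h1, h2]
        simp [h]
  -- All subsets of `W` sum to 0 and the empty set contributes 1, which leaves -1.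
  have h1 := Finset.sum_erase_add W.powerset (fun s => (-1 : ℤ) ^ s.card) (Finset.empty_mem_powerset W)
  rw [← Finset.sum_filter_add_sum_filter_not _ (· ∈ complexOf f), hbad, h0] at h1
  have h2 : (W.powerset.erase ∅).filter (· ∈ complexOf f) = W.powerset.filter (· ∈ complexOf f) := by
    ext s
    simp only [Finset.mem_filter, Finset.mem_erase, and_assoc]
    exact ⟨fun h => h.2, fun h => ⟨Finset.nonempty_iff_ne_empty.1 h.2.1, h⟩⟩
  rw [h2] at h1
  simp at h1
  linarith

/-! ### Multivariate geometric series. -/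

/-- A product of absolutely convergent series, expanded. -/
lemma summable_norm_and_tsum_pi {K ι : Type*} [NormedField K] [CompleteSpace K] {k : ℕ}
    (f : Fin k → ι → K) (hf : ∀ i, Summable fun a => ‖f i a‖) :
    (Summable fun η : Fin k → ι => ‖∏ i, f i (η i)‖) ∧
      ∑' η : Fin k → ι, ∏ i, f i (η i) = ∏ i, ∑' a, f i a := by
  induction k with
  | zero => exact ⟨(hasSum_fintype _).summable, by simp⟩
  | succ k ih =>
    obtain ⟨h1, h2⟩ := ih (fun i => f i.succ) (fun i => hf i.succ)
    let e : ι × (Fin k → ι) ≃ (Fin (k + 1) → ι) := Fin.consEquiv fun _ => ι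
    have key : ∀ p, ∏ i, f i (e p i) = f 0 p.1 * ∏ i : Fin k, f i.succ (p.2 i) := fun p => by
      simp [Fin.prod_univ_succ, Fin.consEquiv, e]
    constructor
    · have h3 : Summable fun p : ι × (Fin k → ι) => ‖∏ i, f i (e p i)‖ := by
        have h4 := Summable.mul_norm (hf 0) h1
        refine h4.congr fun p => ?_
        rw [key]
      exact e.summable_iff.1 h3
    · have h3 := tsum_mul_tsum_of_summable_norm (hf 0) h1
      rw [← e.tsum_eq, Fin.prod_univ_succ, ← h2, h3]
      exact tsum_congr key

section Monomial

variable {d n : ℕ} {A : Matrix (Fin d) (Fin n) ℤ} {z : Fin d → ℂ}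

lemma laurentMonomial_add (hz : ∀ j, z j ≠ 0) (b c : Fin d → ℤ) :
    laurentMonomial z (b + c) = laurentMonomial z b * laurentMonomial z c := by
  simp [laurentMonomial, zpow_add₀ (hz _), Finset.prod_mul_distrib]

lemma laurentMonomial_mulVec (hz : ∀ j, z j ≠ 0) (ξ : Fin n → ℤ) :
    laurentMonomial z (A *ᵥ ξ) = ∏ i, laurentMonomial z (A.col i) ^ ξ i := by
  have hsum : ∀ (w : ℂ), w ≠ 0 → ∀ (t : Finset (Fin n)) (g : Fin n → ℤ),
      w ^ (∑ i ∈ t, g i) = ∏ i ∈ t, w ^ g i := by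
    intro w hw t g
    induction t using Finset.cons_induction with
    | empty => simp
    | cons a t ha ih => rw [Finset.sum_cons, Finset.prod_cons, zpow_add₀ hw, ih]
  simp only [laurentMonomial, ← Finset.prod_zpow]
  rw [Finset.prod_comm]
  refine Finset.prod_congr rfl fun j _ => ?_
  simp only [mulVec, dotProduct]
  rw [hsum _ (hz j)]
  exact Finset.prod_congr rfl fun i _ => by
    rw [_root_.zpow_mul]; rfl

/-- The multivariate geometric series. -/
lemma summable_norm_and_tsum_monomial (hz : z ∈ convergenceDomain A) :
    (Summable fun η : Fin n → ℕ => ‖laurentMonomial z (A *ᵥ fun i => (η i : ℤ))‖) ∧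
      ∑' η : Fin n → ℕ, laurentMonomial z (A *ᵥ fun i => (η i : ℤ)) =
        (∏ i, (1 - laurentMonomial z (A.col i)))⁻¹ := by
  obtain ⟨h0, h1⟩ := hz
  have h := summable_norm_and_tsum_pi (fun (i : Fin n) (a : ℕ) => laurentMonomial z (A.col i) ^ a)
    fun i => by
      simpa only [norm_pow] using summable_geometric_of_lt_one (norm_nonneg _) (h1 i)
  simp only [laurentMonomial_mulVec h0, zpow_natCast]
  refine ⟨h.1, h.2.trans ?_⟩
  rw [← Finset.prod_inv_distrib]
  exact Finset.prod_congr rfl fun i _ => tsum_geometric_of_norm_lt_one (h1 i)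

end Monomial

/-! ### Translation by the lattice. -/

section Translate

variable {n : ℕ} {Λ : AddSubgroup (Fin n → ℤ)}

lemma mem_translate {v u : Λ} {s : Finset Λ} : u ∈ translate v s ↔ u - v ∈ s := by
  simp only [translate, Finset.mem_map, addRightEmbedding_apply]
  exact ⟨by rintro ⟨w, hw, rfl⟩; simpa using hw, fun h => ⟨_, h, by simp⟩⟩

lemma add_mem_translate {v u : Λ} {s : Finset Λ} : u + v ∈ translate v s ↔ u ∈ s := by
  rw [mem_translate, add_sub_cancel_right]

@[simp] lemma translate_zero (s : Finset Λ) : translate 0 s = s := by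
  ext u
  simp [mem_translate]

lemma translate_translate (v w : Λ) (s : Finset Λ) :
    translate v (translate w s) = translate (w + v) s := by
  ext u
  simp only [mem_translate]
  rw [sub_sub, add_comm v w]

lemma card_translate (v : Λ) (s : Finset Λ) : (translate v s).card = s.card :=
  Finset.card_map _

lemma translate_nonempty {v : Λ} {s : Finset Λ} (hs : s.Nonempty) : (translate v s).Nonempty :=
  hs.map

lemma coordMax_translate (v : Λ) {s : Finset Λ} (hs : s.Nonempty) :
    coordMax (fun u : Λ => (u : Fin n → ℤ)) (translate v s) =
      coordMax (fun u : Λ => (u : Fin n → ℤ)) s + v := by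
  funext i
  refine le_antisymm ((coordMax_le_iff (translate_nonempty hs)).2 fun u hu => ?_) ?_
  · have := le_coordMax (f := fun u : Λ => (u : Fin n → ℤ)) (mem_translate.1 hu) i
    simp only [AddSubgroup.coe_sub, Pi.sub_apply, Pi.add_apply] at this ⊢
    linarith
  · rw [Pi.add_apply, ← le_sub_iff_add_le]
    refine (coordMax_le_iff hs).2 fun u hu => ?_
    have := le_coordMax (f := fun u : Λ => (u : Fin n → ℤ)) (add_mem_translate (v := v).2 hu) i
    simp only [AddSubgroup.coe_add, Pi.add_apply] at this
    linarith

lemma IsSetOfRepresentatives.eq_of_translate {S T : Set (Finset Λ)}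
    (hT : IsSetOfRepresentatives S T) {s t : Finset Λ} (hs : s ∈ T) (ht : t ∈ T) {v : Λ}
    (h : t = translate v s) : s = t :=
  (hT.2 s (hT.1 hs)).unique ⟨hs, 0, by simp⟩ ⟨ht, v, h⟩

end Translate

/-! ### Finiteness of the lattice points below a bound. -/

section Kernel

variable {d n : ℕ} {A : Matrix (Fin d) (Fin n) ℤ}

lemma mem_kernelLattice {v : Fin n → ℤ} : v ∈ kernelLattice A ↔ A *ᵥ v = 0 := Iff.rfl

lemma mulVec_coe (v : kernelLattice A) : A *ᵥ (v : Fin n → ℤ) = 0 := v.2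

/-- The positive weights `w i = -⟨l, a_i⟩` are orthogonal to `Λ`, so an upper bound on all
coordinates forces a lower bound on each. -/
lemma finite_setOf_coe_le {l : Fin d → ℝ} (hl : ∀ i, ∑ j, l j * (A j i : ℝ) < 0)
    (ξ : Fin n → ℤ) : {v : kernelLattice A | (v : Fin n → ℤ) ≤ ξ}.Finite := by
  set w : Fin n → ℝ := fun i => -∑ j, l j * (A j i : ℝ) with hw
  have hwpos : ∀ i, 0 < w i := fun i => neg_pos.2 (hl i)
  have hsum : ∀ v : kernelLattice A, ∑ i, w i * ((v : Fin n → ℤ) i : ℝ) = 0 := by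
    intro v
    have h : ∀ j, ∑ i, (A j i : ℝ) * ((v : Fin n → ℤ) i : ℝ) = 0 := fun j => by
      have := congrFun (mulVec_coe v) j
      simp only [mulVec, dotProduct, Pi.zero_apply] at this
      exact_mod_cast this
    simp only [hw, neg_mul, Finset.sum_mul, Finset.sum_neg_distrib]
    rw [Finset.sum_comm, neg_eq_zero]
    refine Finset.sum_eq_zero fun j _ => ?_
    rw [← mul_zero (l j), ← h j, Finset.mul_sum]
    exact Finset.sum_congr rfl fun i _ => by ring
  let C : ℝ := ∑ i, w i * (ξ i : ℝ)
  have hbd : ∀ v : kernelLattice A, (v : Fin n → ℤ) ≤ ξ → ∀ i,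
      ξ i - ⌈C / w i⌉ ≤ (v : Fin n → ℤ) i := by
    intro v hv i
    -- This is one of the nonnegative summands whose total is `C`.
    have h1 : w i * ((ξ i : ℝ) - (v : Fin n → ℤ) i) ≤ C := by
      calc w i * ((ξ i : ℝ) - (v : Fin n → ℤ) i)
          ≤ ∑ i, w i * ((ξ i : ℝ) - (v : Fin n → ℤ) i) :=
            Finset.single_le_sum (f := fun i => w i * ((ξ i : ℝ) - (v : Fin n → ℤ) i))
              (fun i _ => mul_nonneg (hwpos i).le
                (sub_nonneg.2 (by exact_mod_cast hv i))) (Finset.mem_univ i)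
        _ = C := by simp only [mul_sub, Finset.sum_sub_distrib, hsum, sub_zero, C]
    have h2 : (ξ i : ℝ) - (v : Fin n → ℤ) i ≤ C / w i := by
      rw [le_div_iff₀ (hwpos i), mul_comm]
      exact h1
    have h3 : ((ξ i - (v : Fin n → ℤ) i : ℤ) : ℝ) ≤ (⌈C / w i⌉ : ℤ) := by
      push_cast
      exact h2.trans (Int.le_ceil _)
    have h4 : ξ i - (v : Fin n → ℤ) i ≤ ⌈C / w i⌉ := by exact_mod_cast h3
    linarith
  refine Set.Finite.of_finite_image (f := fun v : kernelLattice A => (v : Fin n → ℤ))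
    ((Set.finite_Icc (fun i => ξ i - ⌈C / w i⌉) ξ).subset ?_) Subtype.val_injective.injOn
  rintro _ ⟨v, hv, rfl⟩
  exact ⟨hbd v hv, hv⟩

end Kernel

/-! ### Regrouping the expanded series by exponent. -/

section Main

variable {d n : ℕ} {A : Matrix (Fin d) (Fin n) ℤ} {z : Fin d → ℂ}

/-- One nonnegative preimage per `b` makes this a subfamily of the geometric series. -/
lemma summable_semigroup (hz : z ∈ convergenceDomain A) :
    Summable (fun b : semigroup A => laurentMonomial z b) := by
  have hex : ∀ b : semigroup A, ∃ η : Fin n → ℕ, A *ᵥ (fun i => (η i : ℤ)) = b := by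
    rintro ⟨b, ξ, hξ, rfl⟩
    refine ⟨fun i => (ξ i).toNat, ?_⟩
    congr 1
    funext i
    exact Int.toNat_of_nonneg (hξ i)
  choose η hη using hex
  have hinj : Function.Injective η := fun b c h => Subtype.ext (by rw [← hη b, ← hη c, h])
  refine Summable.of_norm ?_
  have := (summable_norm_and_tsum_monomial hz).1.comp_injective hinj
  refine this.congr fun b => ?_
  simp [hη]

variable {R : Type*} [LinearOrder R] [Zero R] {f : kernelLattice A → Fin n → R}

/-- The points of a fibre of `(s, η) ↦ A (max s + η)` correspond to simplices of the whole
complex that lie below a point of that fibre. -/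
lemma sum_fiber (hn : 0 < n) {l : Fin d → ℝ} (hl : ∀ i, ∑ j, l j * (A j i : ℝ) < 0)
    (hf : ∀ x y i, f x i < f y i → (x : Fin n → ℤ) i ≤ (y : Fin n → ℤ) i)
    (htr : ∀ s ∈ complexOf f, ∀ v, translate v s ∈ complexOf f)
    {T : Set (Finset (kernelLattice A))} (hT : IsSetOfRepresentatives (complexOf f) T)
    {ξ : Fin n → ℤ} (hξ : 0 ≤ ξ) :
    ∑' p : {p : T × (Fin n → ℕ) | A *ᵥ (coordMax (fun v : kernelLattice A => (v : Fin n → ℤ))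
        (p.1 : Finset (kernelLattice A)) + fun i => (p.2 i : ℤ)) = A *ᵥ ξ},
      (-1 : ℂ) ^ ((p.1.1 : Finset (kernelLattice A)).card - 1) = 1 := by
  classical
  set mx := coordMax (fun v : kernelLattice A => (v : Fin n → ℤ)) with hmx
  set W := (finite_setOf_coe_le hl ξ).toFinset with hWdef
  have hWmem : ∀ v, v ∈ W ↔ (v : Fin n → ℤ) ≤ ξ := fun v => by simp [hWdef]
  have hW : W.Nonempty := ⟨0, (hWmem 0).2 (by simpa using hξ)⟩
  have heuler := sum_neg_one_pow_card_filter_complexOf hn f hW (fun s hs hsne v hv => by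
    refine (hWmem v).2 fun i => ?_
    obtain ⟨u, hu, hlt⟩ := (lt_coordMax_iff hsne).1 (hv i)
    exact (hf _ _ _ hlt).trans ((hWmem u).1 (hs hu) i))
  have hsub : ∀ s : Finset (kernelLattice A), s.Nonempty → (s ⊆ W ↔ mx s ≤ ξ) := by
    intro s hs
    constructor
    · exact fun h i => (coordMax_le_iff hs).2 fun v hv => (hWmem v).1 (h hv) i
    · exact fun h v hv => (hWmem v).2 fun i => (le_coordMax
        (f := fun v : kernelLattice A => (v : Fin n → ℤ)) hv i).trans (h i)
  have hne : ∀ t : T, (t : Finset (kernelLattice A)).Nonempty := fun t => (hT.1 t.2).1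
  set P : Set (T × (Fin n → ℕ)) := {p | A *ᵥ (mx (p.1 : Finset (kernelLattice A)) +
    fun i => (p.2 i : ℤ)) = A *ᵥ ξ} with hP
  let Q := W.powerset.filter (· ∈ complexOf f)
  -- Chosen so that the translated simplex has maximum `ξ - η`, from which `η` can be recovered.
  let shift : P → kernelLattice A := fun p =>
    ⟨ξ - (mx (p.1.1 : Finset (kernelLattice A)) + fun i => (p.1.2 i : ℤ)), by
      rw [mem_kernelLattice, mulVec_sub, sub_eq_zero]
      exact p.2.symm⟩
  have hshift : ∀ p : P, mx (translate (shift p) p.1.1) = ξ - fun i => (p.1.2 i : ℤ) := by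
    intro p
    rw [hmx, coordMax_translate _ (hne _), ← hmx]
    simp only [shift]
    abel
  let F : P → Q := fun p => ⟨translate (shift p) p.1.1, by
    refine Finset.mem_filter.2 ⟨Finset.mem_powerset.2 ((hsub _ (translate_nonempty (hne _))).2 ?_),
      htr _ (hT.1 p.1.1.2) _⟩
    rw [hshift]
    intro i
    simp⟩
  have hF : Function.Bijective F := by
    constructor
    · intro p q hpq
      have h1 : translate (shift p) p.1.1 = translate (shift q) (q.1.1 : Finset _) :=
        congrArg Subtype.val hpq
      have h2 : p.1.1 = q.1.1 := by
        refine Subtype.ext (hT.eq_of_translate p.1.1.2 q.1.1.2 (v := shift p - shift q) ?_)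
        rw [sub_eq_add_neg, ← translate_translate, h1, translate_translate, add_neg_cancel,
          translate_zero]
      have h3 : p.1.2 = q.1.2 := by
        have h4 := hshift p
        rw [h1, hshift q] at h4
        funext i
        have := congrFun h4 i
        simp only [Pi.sub_apply] at this
        omega
      exact Subtype.ext (Prod.ext h2 h3)
    · rintro ⟨s, hs⟩
      obtain ⟨hsW, hsS⟩ := Finset.mem_filter.1 hs
      obtain ⟨t, ⟨htT, v, htv⟩, -⟩ := hT.2 s hsS
      have hle : mx s ≤ ξ := (hsub s hsS.1).1 (Finset.mem_powerset.1 hsW)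
      have hη : (fun i => (((ξ i - mx s i).toNat : ℕ) : ℤ)) = ξ - mx s := by
        funext i
        exact Int.toNat_of_nonneg (sub_nonneg.2 (hle i))
      have hmt : mx t = mx s + v := by rw [htv, hmx, coordMax_translate _ hsS.1]
      let p : P := ⟨(⟨t, htT⟩, fun i => (ξ i - mx s i).toNat), by
        change A *ᵥ (mx t + fun i => (((ξ i - mx s i).toNat : ℕ) : ℤ)) = A *ᵥ ξ
        rw [hη, hmt, add_right_comm, add_sub_cancel, mulVec_add, mulVec_coe, add_zero]⟩
      have hsp : shift p = -v := by
        refine Subtype.ext ?_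
        change ξ - (mx t + fun i => (((ξ i - mx s i).toNat : ℕ) : ℤ)) = -(v : Fin n → ℤ)
        rw [hη, hmt]
        abel
      refine ⟨p, Subtype.ext ?_⟩
      change translate (shift p) t = s
      rw [hsp, htv, translate_translate, add_neg_cancel, translate_zero]
  let e := Equiv.ofBijective F hF
  -- The exponent is the dimension, one less than the cardinality; hence the sign against `heuler`.
  have hcard : ∀ p : P, (-1 : ℂ) ^ ((p.1.1 : Finset (kernelLattice A)).card - 1) =
      -(-1 : ℂ) ^ (((e p : Q) : Finset (kernelLattice A)).card) := by
    intro p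
    have h1 : ((e p : Q) : Finset (kernelLattice A)).card =
        (p.1.1 : Finset (kernelLattice A)).card :=
      card_translate _ _
    have h2 := (hne p.1.1).card_pos
    rw [h1]
    obtain ⟨k, hk⟩ := Nat.exists_eq_succ_of_ne_zero h2.ne'
    rw [hk]
    simp [pow_succ]
  rw [tsum_congr hcard, e.tsum_eq (fun s : Q => -(-1 : ℂ) ^ ((s : Finset (kernelLattice A)).card)),
    tsum_fintype, Finset.sum_coe_sort Q (fun s => -(-1 : ℂ) ^ s.card), Finset.sum_neg_distrib]
  have h : ((∑ s ∈ Q, (-1 : ℤ) ^ s.card : ℤ) : ℂ) = ((-1 : ℤ) : ℂ) := congrArg _ heuler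
  push_cast at h
  rw [h, neg_neg]

lemma genFun_eq_complexFun (hn : 0 < n) {l : Fin d → ℝ} (hl : ∀ i, ∑ j, l j * (A j i : ℝ) < 0)
    (hf : ∀ x y i, f x i < f y i → (x : Fin n → ℤ) i ≤ (y : Fin n → ℤ) i)
    (htr : ∀ s ∈ complexOf f, ∀ v, translate v s ∈ complexOf f)
    {T : Set (Finset (kernelLattice A))} (hT : IsSetOfRepresentatives (complexOf f) T)
    (hz : z ∈ convergenceDomain A) (hsum : Summable fun s : T => simplexTerm A z s) :
    genFun A z = complexFun A T z := by
  obtain ⟨hmon, hmon'⟩ := summable_norm_and_tsum_monomial hz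
  let mx := coordMax (fun v : kernelLattice A => (v : Fin n → ℤ))
  let F : T × (Fin n → ℕ) → ℂ := fun p =>
    simplexTerm A z p.1 * laurentMonomial z (A *ᵥ fun i => (p.2 i : ℤ))
  have hFs := summable_mul_of_summable_norm hsum.norm hmon
  have hFt : ∑' p, F p = complexFun A T z := by
    rw [complexFun, div_eq_mul_inv, ← hmon']
    have h := tsum_mul_tsum_of_summable_norm hsum.norm hmon
    exact h.symm
  let g : T × (Fin n → ℕ) → semigroup A := fun p =>
    ⟨A *ᵥ (mx p.1 + fun i => (p.2 i : ℤ)), by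
      obtain ⟨v, hv⟩ := (hT.1 p.1.2).1
      -- Subtracting a vertex of the simplex makes the vector nonnegative without changing its image
      -- under `A`.
      refine ⟨mx p.1 + (fun i => (p.2 i : ℤ)) - v, fun i => ?_, ?_⟩
      · have := le_coordMax (f := fun v : kernelLattice A => (v : Fin n → ℤ)) hv i
        simp only [Pi.zero_apply, Pi.sub_apply, Pi.add_apply, mx]
        have h2 : (0 : ℤ) ≤ (p.2 i : ℤ) := Int.natCast_nonneg _
        linarith
      · rw [mulVec_sub, mulVec_coe, sub_zero]⟩
  have hfib := (hFs.hasSum.tsum_fiberwise g).tsum_eq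
  rw [hFt] at hfib
  rw [← hfib, genFun]
  refine tsum_congr fun b => ?_
  obtain ⟨ξ, hξ, hb⟩ := b.2
  have hset : g ⁻¹' {b} = {p | A *ᵥ (mx p.1 + fun i => (p.2 i : ℤ)) = A *ᵥ ξ} := by
    ext p
    simp only [Set.mem_preimage, Set.mem_singleton_iff, Set.mem_ofPred_eq, g, hb]
    exact Subtype.ext_iff
  have hval : ∀ p : (g ⁻¹' {b} : Set _), F p =
      laurentMonomial z b * (-1 : ℂ) ^ ((p.1.1 : Finset (kernelLattice A)).card - 1) := by
    rintro ⟨p, hp⟩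
    have h1 : A *ᵥ (mx p.1 + fun i => (p.2 i : ℤ)) = b := congrArg Subtype.val hp
    simp only [F, simplexTerm]
    rw [← h1, mulVec_add, laurentMonomial_add hz.1]
    ring
  rw [tsum_congr hval, tsum_mul_left, hset, sum_fiber hn hl hf htr hT hξ, mul_one]

end Main

/-! ### Finiteness in the generic case. -/

section Generic

variable {n : ℕ} {Λ : AddSubgroup (Fin n → ℤ)}

/-- A generic lattice has finitely many neighbors of the origin. -/
lemma IsGeneric.finite_neighbors (hΛ : IsGeneric Λ) :
    {v : Λ | ¬ ∃ w ∈ Λ, ∀ i, w i < max ((v : Fin n → ℤ) i) 0}.Finite := by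
  set N : Set Λ := {v : Λ | ¬ ∃ w ∈ Λ, ∀ i, w i < max ((v : Fin n → ℤ) i) 0} with hN
  suffices h : (N \ {0}).Finite from (h.union (Set.finite_singleton 0)).subset fun v hv => by
    by_cases h0 : v = 0
    · exact Or.inr h0
    · exact Or.inl ⟨hv, h0⟩
  have hnz : ∀ v ∈ N \ {0}, ∀ i, (v : Fin n → ℤ) i ≠ 0 := fun v hv i hi =>
    hv.1 (hΛ v v.2 (fun h => hv.2 (Subtype.ext h)) ⟨i, hi⟩)
  -- Splitting into positive and negative parts makes `r u v` say that each `u i` lies between 0 and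
  -- `v i`. By Dickson's lemma it suffices that nonzero neighbors form an antichain.
  let abs' : Λ → (Fin n → ℕ) × (Fin n → ℕ) := fun v =>
    (fun i => ((v : Fin n → ℤ) i).toNat, fun i => (-(v : Fin n → ℤ) i).toNat)
  let r : Λ → Λ → Prop := fun u v => abs' u ≤ abs' v
  have hwqo : WellQuasiOrdered r := fun s => wellQuasiOrdered_le fun k => abs' (s k)
  refine IsAntichain.finite_of_wellQuasiOrdered (r := r) ?_ hwqo
  intro u hu v hv huv hle
  have h1 : ∀ i, ((u : Fin n → ℤ) i).toNat ≤ ((v : Fin n → ℤ) i).toNat := hle.1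
  have h2 : ∀ i, (-(u : Fin n → ℤ) i).toNat ≤ (-(v : Fin n → ℤ) i).toNat := hle.2
  -- If `r u v` with `u ≠ v`, then `v - u ≤ max(v, 0)`. Either `v - u` is itself strictly below, or
  -- it has a zero coordinate and genericity supplies a vector that is.
  by_cases h0 : ∃ i, ((v - u : Λ) : Fin n → ℤ) i = 0
  · obtain ⟨w, hw, hlt⟩ := hΛ _ (v - u).2
      (fun h => huv (sub_eq_zero.1 (Subtype.ext h : v - u = 0)).symm) h0
    refine hv.1 ⟨w, hw, fun i => (hlt i).trans_le ?_⟩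
    have h1 := h1 i
    have h2 := h2 i
    have h3 := hnz u hu i
    simp only [AddSubgroup.coe_sub, Pi.sub_apply]
    omega
  · refine hv.1 ⟨_, (v - u).2, fun i => ?_⟩
    have h1 := h1 i
    have h2 := h2 i
    have h3 := hnz u hu i
    have h4 : ((v - u : Λ) : Fin n → ℤ) i ≠ 0 := fun h => h0 ⟨i, h⟩
    simp only [AddSubgroup.coe_sub, Pi.sub_apply] at h4 ⊢
    omega

/-- Moving one vertex of each representative to the origin turns it into a set of neighbors of the
origin, and distinct representatives stay distinct. -/
lemma IsGeneric.finite_of_isSetOfRepresentatives (hΛ : IsGeneric Λ) {T : Set (Finset Λ)}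
    (hT : IsSetOfRepresentatives (neighborhoodComplex Λ) T) : T.Finite := by
  have hne : ∀ t : T, (t : Finset Λ).Nonempty := fun t => (hT.1 t.2).1
  choose p hp using hne
  let g : T → Finset Λ := fun t => translate (-p t) (t : Finset Λ)
  have hg : Function.Injective g := fun s t h => by
    refine Subtype.ext (hT.eq_of_translate s.2 t.2 (v := -p s + p t) ?_)
    rw [← translate_translate]
    change _ = translate (p t) (g s)
    rw [h]
    simp [g, translate_translate]
  have hmem : ∀ t, g t ∈ hΛ.finite_neighbors.toFinset.powerset := by
    intro t
    refine Finset.mem_powerset.2 fun u hu => ?_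
    rw [Set.Finite.mem_toFinset]
    rintro ⟨w, hw, hlt⟩
    refine (hT.1 t.2).2 ⟨⟨w, hw⟩ + p t, fun i => ?_⟩
    have h1 := hlt i
    have h2 := le_coordMax (f := fun v : Λ => (v : Fin n → ℤ)) (hp t) i
    have h3 := le_coordMax (f := fun v : Λ => (v : Fin n → ℤ)) (mem_translate.1 hu) i
    simp only [sub_neg_eq_add, AddSubgroup.coe_add, Pi.add_apply] at h1 h2 h3 ⊢
    omega
  exact Finite.of_injective (fun t => (⟨g t, hmem t⟩ : hΛ.finite_neighbors.toFinset.powerset))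
    fun s t h => hg (congrArg Subtype.val h)

end Generic

/-! ### Translation invariance, and summability in the perturbed case. -/

lemma translate_mem_neighborhoodComplex {n : ℕ} {Λ : AddSubgroup (Fin n → ℤ)} {s : Finset Λ}
    (hs : s ∈ neighborhoodComplex Λ) (v : Λ) : translate v s ∈ neighborhoodComplex Λ := by
  refine ⟨translate_nonempty hs.1, fun ⟨w, hw⟩ => hs.2 ⟨w - v, fun i => ?_⟩⟩
  have h := hw i
  rw [coordMax_translate v hs.1] at h
  simp only [AddSubgroup.coe_sub, Pi.sub_apply, Pi.add_apply] at h ⊢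
  linarith

lemma IsProperPerturbation.translate_mem {n : ℕ} {Λ : AddSubgroup (Fin n → ℤ)}
    {φ : Λ → Fin n → ℝ} (hφ : IsProperPerturbation Λ φ) {s : Finset Λ}
    (hs : s ∈ perturbedNeighborhoodComplex Λ φ) (v : Λ) :
    translate v s ∈ perturbedNeighborhoodComplex Λ φ := by
  refine ⟨translate_nonempty hs.1, fun ⟨w, hw⟩ => hs.2 ⟨w - v, fun i => ?_⟩⟩
  obtain ⟨u, hu, hlt⟩ := (lt_coordMax_iff (translate_nonempty hs.1)).1 (hw i)
  refine (lt_coordMax_iff hs.1).2 ⟨u - v, mem_translate.1 hu, ?_⟩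
  simpa only [sub_eq_add_neg] using hφ.add_lt_add _ _ i hlt (-v)

/-- Every vertex of a simplex of the perturbed complex is the highest one in some coordinate. -/
lemma IsProperPerturbation.exists_image_eq {n : ℕ} {Λ : AddSubgroup (Fin n → ℤ)}
    {φ : Λ → Fin n → ℝ} (hφ : IsProperPerturbation Λ φ) {s : Finset Λ}
    (hs : s ∈ perturbedNeighborhoodComplex Λ φ) : ∃ v : Fin n → Λ, ∀ u, u ∈ s ↔ ∃ i, v i = u := by
  have hex : ∀ i, ∃ v ∈ s, ∀ u ∈ s, φ u i ≤ φ v i := fun i =>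
    Finset.exists_max_image s (fun u => φ u i) hs.1
  choose v hv hmax using hex
  refine ⟨v, fun u => ⟨fun hu => ?_, by rintro ⟨i, rfl⟩; exact hv i⟩⟩
  by_contra! hne
  -- A vertex that is nowhere highest is, ties being excluded, strictly below the maximum
  -- everywhere.
  exact hs.2 ⟨u, fun i => (lt_coordMax_iff hs.1).2
    ⟨v i, hv i, lt_of_le_of_ne (hmax i u hu) (hφ.ne_of_ne _ _ (hne i).symm i)⟩⟩

/-- The `n` vectors `max s - v_i`, with `v_i` listing the vertices of `s`, determine `s` up to
translation. Since `A v_i = 0`, each has monomial `z^{A max s}`, so its norm is a product of `n`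
equal `n`-th roots, a term of a product of `n` convergent series. -/
lemma IsProperPerturbation.summable_simplexTerm {d n : ℕ} (hn : 0 < n)
    {A : Matrix (Fin d) (Fin n) ℤ} {φ : kernelLattice A → Fin n → ℝ}
    (hφ : IsProperPerturbation (kernelLattice A) φ) {T : Set (Finset (kernelLattice A))}
    (hT : IsSetOfRepresentatives (perturbedNeighborhoodComplex (kernelLattice A) φ) T)
    {z : Fin d → ℂ} (hz : z ∈ convergenceDomain A) :
    Summable fun s : T => simplexTerm A z s := by
  have hn' : (n : ℝ) ≠ 0 := by exact_mod_cast hn.ne'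
  let M : (Fin n → ℤ) → ℝ := fun ξ => ‖laurentMonomial z (A *ᵥ ξ)‖
  let ρ : Fin n → ℝ := fun j => ‖laurentMonomial z (A.col j)‖ ^ (1 / (n : ℝ))
  have hρ0 : ∀ j, 0 ≤ ρ j := fun j => Real.rpow_nonneg (norm_nonneg _) _
  have hρ1 : ∀ j, ρ j < 1 := fun j => Real.rpow_lt_one (norm_nonneg _) (hz.2 j) (by positivity)
  let G : (Fin n → ℕ) → ℝ := fun η => ∏ j, ρ j ^ η j
  have hG0 : ∀ η, 0 ≤ G η := fun η => Finset.prod_nonneg fun j _ => pow_nonneg (hρ0 j) _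
  have hGM : ∀ η, G η = M (fun i => (η i : ℤ)) ^ (1 / (n : ℝ)) := fun η => by
    simp only [G, M, ρ, laurentMonomial_mulVec hz.1, zpow_natCast, norm_prod, norm_pow]
    rw [← Real.finsetProd_rpow _ _ fun j _ => pow_nonneg (norm_nonneg _) _]
    refine Finset.prod_congr rfl fun j _ => ?_
    rw [← Real.rpow_natCast, ← Real.rpow_mul (norm_nonneg _), mul_comm,
      Real.rpow_mul (norm_nonneg _), Real.rpow_natCast]
  have hGs : Summable fun η => ‖G η‖ :=
    (summable_norm_and_tsum_pi (fun (j : Fin n) (a : ℕ) => ρ j ^ a) fun j => by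
      simpa only [norm_pow, Real.norm_of_nonneg (hρ0 j)] using
        summable_geometric_of_lt_one (hρ0 j) (hρ1 j)).1
  have hGn := (summable_norm_and_tsum_pi (fun _ : Fin n => G) fun _ => hGs).1
  let mx := coordMax (fun v : kernelLattice A => (v : Fin n → ℤ))
  choose v hv using fun s : T => hφ.exists_image_eq (hT.1 s.2)
  let η : T → Fin n → Fin n → ℕ := fun s i j => (mx s j - (v s i : Fin n → ℤ) j).toNat
  have hη : ∀ s i, (fun j => (η s i j : ℤ)) = mx s - (v s i : Fin n → ℤ) := fun s i => by
    funext j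
    exact Int.toNat_of_nonneg (sub_nonneg.2 (le_coordMax
      (f := fun v : kernelLattice A => (v : Fin n → ℤ)) ((hv s _).2 ⟨i, rfl⟩) j))
  have hinj : Function.Injective η := fun s t hst => by
    have h1 : ∀ i, mx s - (v s i : Fin n → ℤ) = mx t - (v t i : Fin n → ℤ) := fun i => by
      rw [← hη, ← hη, hst]
    -- Equal differences give `v t i - v s i = max t - max s` for every `i`, so one translation
    -- moves all vertices.
    let δ : kernelLattice A := v t ⟨0, hn⟩ - v s ⟨0, hn⟩
    have h2 : ∀ i, v t i = v s i + δ := fun i => Subtype.ext <| by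
      funext j
      have h3 := congrFun (h1 i) j
      have h4 := congrFun (h1 ⟨0, hn⟩) j
      simp only [Pi.sub_apply, δ, AddSubgroup.coe_add, AddSubgroup.coe_sub, Pi.add_apply]
        at h3 h4 ⊢
      linarith
    refine Subtype.ext (hT.eq_of_translate s.2 t.2 (v := δ) ?_)
    ext u
    rw [mem_translate, hv, hv]
    exact exists_congr fun i => by rw [h2, eq_sub_iff_add_eq]
  refine Summable.of_norm ((hGn.comp_injective hinj).congr fun s => ?_)
  have h1 : ∀ i, G (η s i) = M (mx s) ^ (1 / (n : ℝ)) := fun i => by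
    rw [hGM, hη]
    simp only [M]
    rw [mulVec_sub, mulVec_coe, sub_zero]
  simp only [Function.comp_apply, h1, Finset.prod_const, Finset.card_univ, Fintype.card_fin]
  rw [← Real.rpow_natCast, ← Real.rpow_mul (norm_nonneg _), one_div, inv_mul_cancel₀ hn',
    Real.rpow_one]
  simp [simplexTerm, mx]

lemma convergenceDomain_mem_nhds {d n : ℕ} {A : Matrix (Fin d) (Fin n) ℤ} {l : Fin d → ℝ}
    (hl : ∀ i, ∑ j, l j * (A j i : ℝ) < 0) :
    convergenceDomain A ∈ 𝓝 (fun j => ((Real.exp (l j) : ℝ) : ℂ)) := by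
  set z₀ : Fin d → ℂ := fun j => ((Real.exp (l j) : ℝ) : ℂ) with hz₀
  have h0 : ∀ j, z₀ j ≠ 0 := fun j => by
    simp only [hz₀]
    exact_mod_cast (Real.exp_pos _).ne'
  refine Filter.inter_mem (f := 𝓝 z₀) (s := {z | ∀ j, z j ≠ 0})
    (t := {z | ∀ i, ‖laurentMonomial z (A.col i)‖ < 1})
    (Filter.eventually_all.2 fun j => (continuous_apply j).continuousAt.eventually_ne (h0 j))
    (Filter.eventually_all.2 fun i => ?_)
  have hc : ContinuousAt (fun z : Fin d → ℂ => ‖laurentMonomial z (A.col i)‖) z₀ := by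
    refine ContinuousAt.norm (tendsto_finsetProd _ fun j _ => ?_)
    exact ((continuous_apply j).continuousAt (x := z₀)).zpow₀ _ (Or.inl (h0 j))
  refine hc.eventually_lt continuousAt_const ?_
  -- At this point the monomial has norm `e^{⟨l, a_i⟩}`, which is less than 1.
  have h1 : ‖laurentMonomial z₀ (A.col i)‖ = Real.exp (∑ j, l j * (A j i : ℝ)) := by
    rw [Real.exp_sum, laurentMonomial, norm_prod]
    refine Finset.prod_congr rfl fun j _ => ?_
    rw [norm_zpow, hz₀, Complex.norm_real, Real.norm_of_nonneg (Real.exp_pos _).le,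
      ← Real.rpow_intCast, ← Real.exp_mul]
    rfl
  rw [h1]
  exact Real.exp_zero ▸ Real.exp_lt_exp.2 (hl i)

end SemigroupGF

open SemigroupGF
theorem mainTheorem1 {d n : ℕ} (hn : 0 < n) (A : Matrix (Fin d) (Fin n) ℤ)
    (l : Fin d → ℝ) (hl : ∀ i, ∑ j, l j * (A j i : ℝ) < 0) :
    convergenceDomain A ∈ 𝓝 (fun j => ((Real.exp (l j) : ℝ) : ℂ)) ∧
    (IsGeneric (kernelLattice A) →
      ∀ T : Set (Finset (kernelLattice A)),
        IsSetOfRepresentatives (neighborhoodComplex (kernelLattice A)) T →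
          T.Finite ∧ GenFunEq A T) ∧
    (∀ φ : kernelLattice A → Fin n → ℝ, IsProperPerturbation (kernelLattice A) φ →
      ∀ T : Set (Finset (kernelLattice A)),
        IsSetOfRepresentatives (perturbedNeighborhoodComplex (kernelLattice A) φ) T →
          GenFunEq A T) := by
  refine ⟨convergenceDomain_mem_nhds hl, fun hΛ T hT => ?_, fun φ hφ T hT z hz => ?_⟩
  · have hfin := hΛ.finite_of_isSetOfRepresentatives hT
    refine ⟨hfin, fun z hz => ?_⟩
    have : Finite T := hfin
    have hsum : Summable fun s : T => simplexTerm A z s := Summable.of_finite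
    exact ⟨summable_semigroup hz, hsum, genFun_eq_complexFun hn hl (fun _ _ _ h => h.le)
      (fun s hs v => translate_mem_neighborhoodComplex hs v) hT hz hsum⟩
  · have hsum := hφ.summable_simplexTerm hn hT hz
    exact ⟨summable_semigroup hz, hsum, genFun_eq_complexFun hn hl
      (fun x y i h => hφ.le_of_lt x y i h) (fun s hs v => hφ.translate_mem hs v) hT hz hsum⟩
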